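/- Let $C$ be a coalgebra over a field $K$, and let $C^*=\operatorname{Hom}_K(C,K)$ be its dual algebra, with convolution product $(f*g)(c)=\sum f(c_1)g(c_2)$. A left (right) $C^*$-module $M$ is called rational if its structure is induced by a right (left) $C$-comodule structure, i.e. if for every $m\in M$ there are finitely many $m_i\in M$, $c_i\in C$ with $f\cdot m=\sum_i f(c_i)m_i$ (respectively $m\cdot f=\sum_i f(c_i)m_i$) for all $f\in C^*$. Equip $C^*$ with the finite topology, in which the subspaces $X^\perp=\{f\in C^*: f|_X=0\}$, for $X\subseteq C$ finite dimensional, form a basis of neighbourhoods of $0$. A subspace of $C^*$ is called cofinite if it has finite codimension; a left (right) subcomodule of $C$ is a subspace $X$ with $\Delta(X)\subseteq C\otimes X$ (respectively $\Delta(X)\subseteq X\otimes C$). The product $IJ$ of two ideals (or subspaces) is the set of finite sums of products $fg$ with $f\in I$, $g\in J$. A subspace of $C^*$ is closed and cofinite if and only if it is open. Moreover, the following assertions are equivalent: (i) The finite dimensional rational left $C^*$-modules are closed under extensions: for every exact sequence $0\to M'\to M\to M''\to 0$ of left $C^*$-modules with $M'$ and $M''$ finite dimensional and rational, $M$ is finite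 dimensional and rational. Equivalently, the same holds for right $C^*$-modules. (ii) The set of closed cofinite left ideals of $C^*$ (equivalently, of open left ideals) is closed under products. Equivalently, $X^\perp Y^\perp$ is closed and cofinite whenever $X,Y$ are finite dimensional left subcomodules of $C$. (iii) The set of closed cofinite two-sided ideals of $C^*$ is closed under products. (iv) The set of closed cofinite right ideals of $C^*$ (equivalently, of open right ideals) is closed under products. Equivalently, $X^\perp Y^\perp$ is closed and cofinite whenever $X,Y$ are finite dimensional right subcomodules of $C$. -/

import Mathlib

namespace RationalExt

open scoped TensorProduct

universe u v

section

variable (K : Type u) (C : Type v) [Field K] [AddCommGroup C] [Module K C] [Coalgebra K C]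

/-- The dual algebra `C^*` of a coalgebra `C`: the linear functionals on `C`, with the convolution
product `(f * g)(c) = ∑ f(c₁) g(c₂)` and unit the counit. -/
abbrev DualAlg : Type (max u v) := WithConv (C →ₗ[K] K)

/-- The finite topology on `C^*`: the sets `f + X^⊥`, with `X` a finite dimensional subspace of `C`,
form a basis of neighbourhoods of `f`. -/
def finiteTopology : TopologicalSpace (DualAlg K C) where
  IsOpen U := ∀ f ∈ U, ∃ X : Submodule K C, FiniteDimensional K X ∧
    ∀ g : DualAlg K C, (∀ x ∈ X, g x = f x) → g ∈ U
  isOpen_univ := fun _ _ => ⟨⊥, inferInstance, fun _ _ => trivial⟩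
  isOpen_inter := by
    rintro U V hU hV f ⟨hfU, hfV⟩
    obtain ⟨X, hX, hXU⟩ := hU f hfU
    obtain ⟨Y, hY, hYV⟩ := hV f hfV
    exact ⟨X ⊔ Y, inferInstance, fun g hg =>
      ⟨hXU g fun x hx => hg x (Submodule.mem_sup_left hx),
        hYV g fun y hy => hg y (Submodule.mem_sup_right hy)⟩⟩
  isOpen_sUnion := by
    rintro S hS f ⟨U, hUS, hfU⟩
    obtain ⟨X, hX, hXU⟩ := hS U hUS f hfU
    exact ⟨X, hX, fun g hg => ⟨U, hUS, hXU g hg⟩⟩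

end

section

variable {K : Type u} {C : Type v} [Field K] [AddCommGroup C] [Module K C] [Coalgebra K C]

/-- `X^⊥`, the functionals vanishing on the subspace `X` of `C`. -/
def perp (X : Submodule K C) : Submodule K (DualAlg K C) where
  carrier := {f | ∀ x ∈ X, f x = 0}
  zero_mem' := fun _ _ => rfl
  add_mem' := by
    intro f g hf hg x hx
    have h : (f + g) x = f x + g x := rfl
    rw [h, hf x hx, hg x hx, add_zero]
  smul_mem' := by
    intro a f hf x hx
    have h : (a • f) x = a • f x := rfl
    rw [h, hf x hx, smul_zero]

/-- `X` is a left subcomodule of `C`: `Δ(X) ⊆ C ⊗ X`. -/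
def IsLeftSubcomodule (X : Submodule K C) : Prop :=
  ∀ x ∈ X, Coalgebra.comul (R := K) x ∈ LinearMap.range (X.subtype.lTensor C)

/-- `X` is a right subcomodule of `C`: `Δ(X) ⊆ X ⊗ C`. -/
def IsRightSubcomodule (X : Submodule K C) : Prop :=
  ∀ x ∈ X, Coalgebra.comul (R := K) x ∈ LinearMap.range (X.subtype.rTensor C)

/-! One-sided and two-sided ideals of the unital `K`-algebra `C^*` are automatically `K`-subspaces;
they are treated as such, so that the product `I * J` is Mathlib's product of subspaces of an
algebra, i.e. the set of finite sums of products `f * g` with `f ∈ I` and `g ∈ J`. -/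

/-- `I` is a left ideal of `C^*`. -/
def IsLeftIdeal (I : Submodule K (DualAlg K C)) : Prop :=
  ∀ (f : DualAlg K C), ∀ g ∈ I, f * g ∈ I

/-- `I` is a right ideal of `C^*`. -/
def IsRightIdeal (I : Submodule K (DualAlg K C)) : Prop :=
  ∀ (f : DualAlg K C), ∀ g ∈ I, g * f ∈ I

/-- `I` is closed in the finite topology. -/
def IsClosedSubspace (I : Submodule K (DualAlg K C)) : Prop :=
  @IsClosed (DualAlg K C) (finiteTopology K C) (I : Set (DualAlg K C))

/-- `I` is open in the finite topology. -/
def IsOpenSubspace (I : Submodule K (DualAlg K C)) : Prop :=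
  @IsOpen (DualAlg K C) (finiteTopology K C) (I : Set (DualAlg K C))

/-- `I` has finite codimension in `C^*`. -/
def IsCofinite (I : Submodule K (DualAlg K C)) : Prop :=
  FiniteDimensional K (DualAlg K C ⧸ I)

end

section

variable (K : Type u) (C : Type v) [Field K] [AddCommGroup C] [Module K C] [Coalgebra K C]

/-- The set of closed cofinite left ideals of `C^*`. -/
def closedCofiniteLeftIdeals : Set (Submodule K (DualAlg K C)) :=
  {I | IsLeftIdeal I ∧ IsClosedSubspace I ∧ IsCofinite I}

/-- The set of closed cofinite right ideals of `C^*`. -/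
def closedCofiniteRightIdeals : Set (Submodule K (DualAlg K C)) :=
  {I | IsRightIdeal I ∧ IsClosedSubspace I ∧ IsCofinite I}

/-- The set of closed cofinite two-sided ideals of `C^*`. -/
def closedCofiniteTwoSidedIdeals : Set (Submodule K (DualAlg K C)) :=
  {I | IsLeftIdeal I ∧ IsRightIdeal I ∧ IsClosedSubspace I ∧ IsCofinite I}

/-- A left `C^*`-module `M` is rational: for every `m` there is `∑ mᵢ ⊗ cᵢ` in `M ⊗ C` such that
`f m = ∑ f(cᵢ) mᵢ` for all `f` in `C^*`. These are the left modules that come from a right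
`C`-comodule. -/
def IsRationalLeft (M : Type*) [AddCommGroup M] [Module K M] [Module (DualAlg K C) M] : Prop :=
  ∀ m : M, ∃ t : M ⊗[K] C, ∀ f : DualAlg K C,
    f • m = TensorProduct.rid K M (f.ofConv.lTensor M t)

/-- A right `C^*`-module `M` is rational: for every `m` there is `∑ cᵢ ⊗ mᵢ` in `C ⊗ M` such that
`m f = ∑ f(cᵢ) mᵢ` for all `f` in `C^*`. These are the right modules that come from a left
`C`-comodule. -/
def IsRationalRight (M : Type*) [AddCommGroup M] [Module K M] [Module (DualAlg K C)ᵐᵒᵖ M] : Prop :=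
  ∀ m : M, ∃ t : C ⊗[K] M, ∀ f : DualAlg K C,
    MulOpposite.op f • m = TensorProduct.lid K M (f.ofConv.rTensor M t)

/-- Finite dimensional rational left `C^*`-modules are closed under extensions in the category of
all left `C^*`-modules: for every short exact sequence `0 → M₁ → M → M₂ → 0` of left `C^*`-modules
with finite dimensional rational ends, `M` is finite dimensional and rational. -/
def LeftRationalClosedUnderExt : Prop :=
  ∀ (M₁ M M₂ : Type (max u v))
    [AddCommGroup M₁] [Module K M₁] [Module (DualAlg K C) M₁] [IsScalarTower K (DualAlg K C) M₁]
    [AddCommGroup M] [Module K M] [Module (DualAlg K C) M] [IsScalarTower K (DualAlg K C) M]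
    [AddCommGroup M₂] [Module K M₂] [Module (DualAlg K C) M₂] [IsScalarTower K (DualAlg K C) M₂]
    (i : M₁ →ₗ[DualAlg K C] M) (p : M →ₗ[DualAlg K C] M₂),
    Function.Injective i → Function.Exact i p → Function.Surjective p →
    FiniteDimensional K M₁ → IsRationalLeft K C M₁ →
    FiniteDimensional K M₂ → IsRationalLeft K C M₂ →
    FiniteDimensional K M ∧ IsRationalLeft K C M

/-- Finite dimensional rational right `C^*`-modules are closed under extensions in the category of
all right `C^*`-modules. -/
def RightRationalClosedUnderExt : Prop :=
  ∀ (M₁ M M₂ : Type (max u v))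
    [AddCommGroup M₁] [Module K M₁] [Module (DualAlg K C)ᵐᵒᵖ M₁]
    [IsScalarTower K (DualAlg K C)ᵐᵒᵖ M₁]
    [AddCommGroup M] [Module K M] [Module (DualAlg K C)ᵐᵒᵖ M]
    [IsScalarTower K (DualAlg K C)ᵐᵒᵖ M]
    [AddCommGroup M₂] [Module K M₂] [Module (DualAlg K C)ᵐᵒᵖ M₂]
    [IsScalarTower K (DualAlg K C)ᵐᵒᵖ M₂]
    (i : M₁ →ₗ[(DualAlg K C)ᵐᵒᵖ] M) (p : M →ₗ[(DualAlg K C)ᵐᵒᵖ] M₂),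
    Function.Injective i → Function.Exact i p → Function.Surjective p →
    FiniteDimensional K M₁ → IsRationalRight K C M₁ →
    FiniteDimensional K M₂ → IsRationalRight K C M₂ →
    FiniteDimensional K M ∧ IsRationalRight K C M

end

end RationalExt

/-! Every condition in the list is equivalent to one that mentions neither sides nor modules:
products of open subspaces of `C^*` are open (`ProductsOpen`).

For ideals and subcomodules this rests on the fundamental theorem of coalgebras. Any two open
subspaces contain a common `D^⊥` with `D` a finite dimensional subcoalgebra, so it suffices that
`D^⊥ D^⊥` is open. Such a `D` is a left and a right subcomodule and `D^⊥` is a two-sided ideal, so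
each version of the condition applies to it (`productsOpen_of_slice_stable`).

For modules, a finite dimensional module is rational exactly when some `X^⊥` kills it. If `D^⊥`
kills both ends of an extension, `D^⊥ D^⊥` kills the middle. Conversely, let `φ` be a functional on
`C^*` killing `J = D^⊥ D^⊥`. The cyclic module obtained by dividing `C^*` by the largest left ideal
in `ker φ` is an extension of finite dimensional modules killed by `D^⊥`. It is therefore rational,
and `φ` is evaluation at a point of `C`. When all functionals killing `J` are evaluations, `C^*/J`
is reflexive, hence finite dimensional, and `J` is open (`exists_annihilator_le`). -/

namespace RationalExt

open scoped TensorProduct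

universe u v w

/-! ### Linear duality for a space `A` identified with the dual of `C`. -/

section Dual

variable {K : Type u} {C : Type v} {A : Type w} [Field K] [AddCommGroup C] [Module K C]
  [AddCommGroup A] [Module K A] (e : A ≃ₗ[K] (C →ₗ[K] K))

/-- The elements of `A ≃ C^*` that vanish on the subspace `X` of `C`. -/
def annihilator (X : Submodule K C) : Submodule K A where
  carrier := {a | ∀ x ∈ X, e a x = 0}
  zero_mem' := by simp
  add_mem' := by
    intro a b ha hb x hx
    simp [ha x hx, hb x hx]
  smul_mem' := by
    intro k a ha x hx
    simp [ha x hx]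

theorem annihilator_anti {X Y : Submodule K C} (h : X ≤ Y) :
    annihilator e Y ≤ annihilator e X := fun _ ha x hx => ha x (h hx)

/-- Take for `x` a basis of `X` and for `b` extensions to `C` of its coordinate functionals. A
linear map killing `X^⊥` is then given by a finite formula in the values `e a (x i)`. -/
theorem exists_dual_expansion (X : Submodule K C) [FiniteDimensional K X] :
    ∃ (n : ℕ) (x : Fin n → C) (b : Fin n → A), ∀ a : A,
      a - ∑ i, e a (x i) • b i ∈ annihilator e X := by
  let B := Module.finBasis K X
  choose g hg using fun i => LinearMap.exists_extend (B.coord i)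
  refine ⟨_, fun i => (B i : C), fun i => e.symm (g i), fun a x hx => ?_⟩
  have h1 : ∀ i, g i x = B.repr ⟨x, hx⟩ i := fun i => by
    have := LinearMap.congr_fun (hg i) ⟨x, hx⟩
    simpa using this
  have h2 : e a x = ∑ i, B.repr ⟨x, hx⟩ i * e a (B i) := by
    have := congrArg (e a ∘ₗ X.subtype) (B.sum_repr ⟨x, hx⟩)
    rw [map_sum] at this
    exact this.symm.trans (Finset.sum_congr rfl fun i _ => map_smul (e a ∘ₗ X.subtype) _ _)
  simp [h1, h2, mul_comm]

theorem exists_eq_eval {X : Submodule K C} [FiniteDimensional K X] (φ : A →ₗ[K] K)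
    (hφ : ∀ a ∈ annihilator e X, φ a = 0) : ∃ c : C, ∀ a, φ a = e a c := by
  obtain ⟨n, x, b, h⟩ := exists_dual_expansion e X
  refine ⟨∑ i, φ (b i) • x i, fun a => ?_⟩
  have := hφ _ (h a)
  rw [map_sub, sub_eq_zero] at this
  simp [this, mul_comm]

theorem exists_tensor_of_annihilator {M : Type*} [AddCommGroup M] [Module K M]
    {X : Submodule K C} [FiniteDimensional K X] (Φ : A →ₗ[K] M)
    (hΦ : ∀ a ∈ annihilator e X, Φ a = 0) :
    ∃ t : M ⊗[K] C, ∀ a, Φ a = TensorProduct.rid K M ((e a).lTensor M t) := by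
  obtain ⟨n, x, b, h⟩ := exists_dual_expansion e X
  refine ⟨∑ i, Φ (b i) ⊗ₜ x i, fun a => ?_⟩
  have := hΦ _ (h a)
  rw [map_sub, sub_eq_zero] at this
  simp [this]

theorem finiteDimensional_of_surjective_of_annihilator {M : Type*} [AddCommGroup M] [Module K M]
    {X : Submodule K C} [FiniteDimensional K X] (Φ : A →ₗ[K] M) (hs : Function.Surjective Φ)
    (hΦ : ∀ a ∈ annihilator e X, Φ a = 0) : FiniteDimensional K M := by
  obtain ⟨n, x, b, h⟩ := exists_dual_expansion e X
  refine Module.Finite.of_surjective (Fintype.linearCombination K fun i => Φ (b i)) fun m => ?_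
  obtain ⟨a, rfl⟩ := hs m
  have := hΦ _ (h a)
  rw [map_sub, sub_eq_zero] at this
  refine ⟨fun i => e a (x i), ?_⟩
  simp [this, Fintype.linearCombination_apply]

/-- A subspace `J` of `C^*` contains some `X^⊥` with `X` finite dimensional, as soon as all
functionals on `C^*` that kill `J` are evaluations at points of `C`. -/
theorem exists_annihilator_le (J : Submodule K A)
    (h : ∀ φ : A →ₗ[K] K, (∀ a ∈ J, φ a = 0) → ∃ c : C, ∀ a, φ a = e a c) :
    ∃ X : Submodule K C, FiniteDimensional K X ∧ annihilator e X ≤ J := by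
  let W : Submodule K C :=
    { carrier := {c | ∀ a ∈ J, e a c = 0}
      zero_mem' := by simp
      add_mem' := by
        intro c d hc hd a ha
        simp [hc a ha, hd a ha]
      smul_mem' := by
        intro k c hc a ha
        simp [hc a ha] }
  let θ : W →ₗ[K] Module.Dual K (A ⧸ J) :=
    { toFun := fun c => J.liftQ (e.toLinearMap.flip c) fun a ha => c.2 a ha
      map_add' := by
        intro c d
        ext a
        exact map_add (e a) (c : C) d
      map_smul' := by
        intro k c
        ext a
        exact map_smul (e a) k (c : C) }
  have hθ : ∀ (c : W) (a : A), θ c (J.mkQ a) = e a c := fun _ _ => rfl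
  have hinj : Function.Injective θ := by
    rw [injective_iff_map_eq_zero]
    intro c hc
    refine Subtype.ext ?_
    change (c : C) = 0
    rw [← Module.forall_dual_apply_eq_zero_iff K]
    intro f
    have := hθ c (e.symm f)
    simpa [hc] using this.symm
  have hsurj : Function.Surjective θ := by
    intro φ
    obtain ⟨c, hc⟩ := h (φ ∘ₗ J.mkQ) fun a ha => by
      have : J.mkQ a = 0 := by simpa using ha
      simp only [LinearMap.comp_apply, this, map_zero]
    refine ⟨⟨c, fun a ha => ?_⟩, ?_⟩
    · rw [← hc, LinearMap.comp_apply, (by simpa using ha : J.mkQ a = 0), map_zero]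
    · ext a
      exact (hθ _ a).trans (hc a).symm
  let θe := LinearEquiv.ofBijective θ ⟨hinj, hsurj⟩
  -- Via `θ`, an element of the double dual of `A ⧸ J` is a functional on `W`. It extends to `C`, so
  -- it comes from an element of `A`. Reflexive spaces over a field are finite dimensional.
  have : Module.IsReflexive K (A ⧸ J) := by
    refine ⟨⟨?_, fun ξ => ?_⟩⟩
    · exact Module.eval_apply_injective K
    · obtain ⟨f, hf⟩ := LinearMap.exists_extend (ξ ∘ₗ θ)
      refine ⟨J.mkQ (e.symm f), ?_⟩
      ext φ
      obtain ⟨c, rfl⟩ := hsurj φ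
      have := LinearMap.congr_fun hf c
      rw [Module.Dual.eval_apply, hθ]
      simpa using this
  have : FiniteDimensional K W := LinearEquiv.finiteDimensional θe.symm
  refine ⟨W, this, fun a ha => ?_⟩
  have : J.mkQ a = 0 := by
    rw [← Module.forall_dual_apply_eq_zero_iff K]
    intro φ
    obtain ⟨c, rfl⟩ := hsurj φ
    rw [hθ]
    exact ha _ c.2
  simpa using this

end Dual

/-! ### Extensions of rational modules and squares of two-sided ideals. -/

section Algebra

variable {K : Type u} {C : Type v} {A : Type w} [Field K] [AddCommGroup C] [Module K C]
  [Ring A] [Algebra K A] (e : A ≃ₗ[K] (C →ₗ[K] K))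

/-- Rationality of a left module over an algebra identified with the dual space of `C`. -/
def IsRational (M : Type*) [AddCommGroup M] [Module K M] [Module A M] : Prop :=
  ∀ m : M, ∃ t : M ⊗[K] C, ∀ a : A, a • m = TensorProduct.rid K M ((e a).lTensor M t)

/-- Finite dimensional rational modules are closed under extensions. -/
def ClosedUnderExt : Prop :=
  ∀ (M₁ M M₂ : Type w)
    [AddCommGroup M₁] [Module K M₁] [Module A M₁] [IsScalarTower K A M₁]
    [AddCommGroup M] [Module K M] [Module A M] [IsScalarTower K A M]
    [AddCommGroup M₂] [Module K M₂] [Module A M₂] [IsScalarTower K A M₂]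
    (i : M₁ →ₗ[A] M) (p : M →ₗ[A] M₂),
    Function.Injective i → Function.Exact i p → Function.Surjective p →
    FiniteDimensional K M₁ → IsRational e M₁ →
    FiniteDimensional K M₂ → IsRational e M₂ →
    FiniteDimensional K M ∧ IsRational e M

/-- `X^⊥` is a two-sided ideal. -/
def AnnihilatorIsTwoSided (X : Submodule K C) : Prop :=
  ∀ a, ∀ b ∈ annihilator e X, a * b ∈ annihilator e X ∧ b * a ∈ annihilator e X

/-- The squares of the open two-sided ideals `X^⊥` are open. -/
def SquaresOpen : Prop :=
  ∀ X : Submodule K C, FiniteDimensional K X → AnnihilatorIsTwoSided e X →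
    ∃ Y : Submodule K C, FiniteDimensional K Y ∧
      annihilator e Y ≤ annihilator e X * annihilator e X

/-- Every finite dimensional `X` lies in a finite dimensional `Y` with `Y^⊥` a two-sided ideal. -/
def HasEnoughTwoSided : Prop :=
  ∀ X : Submodule K C, FiniteDimensional K X →
    ∃ Y : Submodule K C, FiniteDimensional K Y ∧ X ≤ Y ∧ AnnihilatorIsTwoSided e Y

theorem exists_finiteDimensional_lTensor_eq_zero {M : Type*} [AddCommGroup M] [Module K M]
    (t : M ⊗[K] C) : ∃ X : Submodule K C, FiniteDimensional K X ∧
      ∀ f : C →ₗ[K] K, (∀ x ∈ X, f x = 0) → f.lTensor M t = 0 := by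
  induction t with
  | zero => exact ⟨⊥, inferInstance, by simp⟩
  | tmul m c =>
    refine ⟨K ∙ c, inferInstance, fun f hf => ?_⟩
    simp [hf c (Submodule.mem_span_singleton_self c)]
  | add s t hs ht =>
    obtain ⟨X, hX, hXs⟩ := hs
    obtain ⟨Y, hY, hYt⟩ := ht
    refine ⟨X ⊔ Y, inferInstance, fun f hf => ?_⟩
    rw [map_add, hXs f fun x hx => hf x (Submodule.mem_sup_left hx),
      hYt f fun y hy => hf y (Submodule.mem_sup_right hy), add_zero]

/-- Each basis vector involves only finitely many elements of `C`; the sum of the subspaces they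
span works for all of `M`. -/
theorem IsRational.exists_annihilator {M : Type*} [AddCommGroup M] [Module K M] [Module A M]
    [IsScalarTower K A M] [FiniteDimensional K M] (h : IsRational e M) :
    ∃ X : Submodule K C, FiniteDimensional K X ∧ ∀ a ∈ annihilator e X, ∀ m : M, a • m = 0 := by
  have : SMulCommClass A K M := IsScalarTower.to_smulCommClass'
  let B := Module.finBasis K M
  have h1 (i) : ∃ X : Submodule K C, FiniteDimensional K X ∧
      ∀ a ∈ annihilator e X, a • B i = 0 := by
    obtain ⟨t, ht⟩ := h (B i)
    obtain ⟨X, hX, hXt⟩ := exists_finiteDimensional_lTensor_eq_zero t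
    exact ⟨X, hX, fun a ha => by rw [ht, hXt _ ha, map_zero]⟩
  choose X hX hXB using h1
  refine ⟨⨆ i, X i, inferInstance, fun a ha m => ?_⟩
  rw [← B.sum_repr m, Finset.smul_sum]
  refine Finset.sum_eq_zero fun i _ => ?_
  rw [smul_comm, hXB i a (annihilator_anti e (le_iSup X i) ha), smul_zero]

theorem isRational_of_annihilator {M : Type*} [AddCommGroup M] [Module K M] [Module A M]
    [IsScalarTower K A M] {X : Submodule K C} [FiniteDimensional K X]
    (h : ∀ a ∈ annihilator e X, ∀ m : M, a • m = 0) : IsRational e M := fun m =>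
  exists_tensor_of_annihilator e ((LinearMap.toSpanSingleton A M m).restrictScalars K)
    fun a ha => h a ha m

theorem SquaresOpen.closedUnderExt (hC : HasEnoughTwoSided e) (h : SquaresOpen e) :
    ClosedUnderExt e := by
  intro M₁ M M₂ _ _ _ _ _ _ _ _ _ _ _ _ i p hi hip hp hM₁ hr₁ hM₂ hr₂
  obtain ⟨X₁, hX₁, h₁⟩ := hr₁.exists_annihilator
  obtain ⟨X₂, hX₂, h₂⟩ := hr₂.exists_annihilator
  obtain ⟨D, hD, hXD, hDt⟩ := hC (X₁ ⊔ X₂) inferInstance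
  obtain ⟨Y, hY, hYD⟩ := h D hD hDt
  constructor
  · exact Module.Finite.of_exact (f := i.restrictScalars K) (g := p.restrictScalars K) hip hp
  · refine isRational_of_annihilator e (X := Y) fun a ha m => ?_
    refine Submodule.mul_induction_on (hYD ha) (fun b hb c hc => ?_) (fun b c hb hc => ?_)
    · have hpc : p (c • m) = 0 := by
        rw [map_smul, h₂ c (annihilator_anti e (le_sup_right.trans hXD) hc)]
      obtain ⟨m₁, hm₁⟩ := (hip _).1 hpc
      rw [mul_smul, ← hm₁, ← map_smul, h₁ b (annihilator_anti e (le_sup_left.trans hXD) hb),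
        map_zero]
    · rw [add_smul, hb, hc, add_zero]

/-- By `exists_annihilator_le` it is enough to treat one functional `φ` killing the square at a
time; the extension to test is `0 → P → A ⧸ N → (A ⧸ N) ⧸ P → 0`. -/
theorem ClosedUnderExt.squaresOpen (h : ClosedUnderExt e) : SquaresOpen e := by
  intro D hD hDt
  refine exists_annihilator_le e _ fun φ hφ => ?_
  let Ψ : A →ₗ[K] Module.Dual K A := (LinearMap.mul K A).flip.compr₂ φ
  have hΨ : ∀ b a, Ψ b a = φ (a * b) := fun _ _ => rfl
  -- The largest left ideal contained in `ker φ`.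
  let N : Submodule A A :=
    { LinearMap.ker Ψ with
      smul_mem' := by
        intro c b hb
        replace hb : Ψ b = 0 := hb
        change Ψ (c • b) = 0
        ext a
        rw [hΨ, smul_eq_mul, ← mul_assoc, ← hΨ, hb]
        rfl }
  have hN : ∀ b, b ∈ N ↔ Ψ b = 0 := fun _ => Iff.rfl
  let I : Submodule A A := { annihilator e D with smul_mem' := fun c b hb => (hDt c b hb).1 }
  have hI : ∀ b, b ∈ I ↔ b ∈ annihilator e D := fun _ => Iff.rfl
  let P : Submodule A (A ⧸ N) := I.map N.mkQ
  have hP₁ : ∀ a ∈ annihilator e D, ∀ m : P, a • m = 0 := by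
    rintro a ha ⟨_, b, hb, rfl⟩
    refine Subtype.ext ?_
    change a • N.mkQ b = 0
    rw [← map_smul, Submodule.mkQ_apply, Submodule.Quotient.mk_eq_zero, hN]
    ext c
    rw [hΨ, smul_eq_mul, ← mul_assoc]
    exact hφ _ (Submodule.mul_mem_mul (hDt c a ha).1 hb)
  have hP₂ : ∀ a ∈ annihilator e D, ∀ m : (A ⧸ N) ⧸ P, a • m = 0 := by
    intro a ha m
    obtain ⟨m, rfl⟩ := P.mkQ_surjective m
    obtain ⟨b, rfl⟩ := N.mkQ_surjective m
    rw [← map_smul, ← map_smul, Submodule.mkQ_apply, Submodule.Quotient.mk_eq_zero]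
    exact ⟨_, (hDt b a ha).2, rfl⟩
  have hf₂ : FiniteDimensional K ((A ⧸ N) ⧸ P) := by
    refine finiteDimensional_of_surjective_of_annihilator e (X := D)
      ((P.mkQ ∘ₗ N.mkQ).restrictScalars K) (P.mkQ_surjective.comp N.mkQ_surjective) fun a ha => ?_
    have := hP₂ a ha (P.mkQ (N.mkQ 1))
    rwa [← map_smul, ← map_smul, smul_eq_mul, mul_one] at this
  -- For `c` in `D^⊥`, `φ (a * c)` depends only on `a` modulo `D^⊥`. Hence `c` lies in `N` as soon
  -- as the finitely many numbers `φ (b i * c)` vanish.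
  have hf₁ : FiniteDimensional K P := by
    obtain ⟨n, x, b, hb⟩ := exists_dual_expansion e D
    let γ : annihilator e D →ₗ[K] (Fin n → K) :=
      LinearMap.pi fun i => φ ∘ₗ LinearMap.mulLeft K (b i) ∘ₗ (annihilator e D).subtype
    let s : annihilator e D →ₗ[K] P :=
      (N.mkQ.restrictScalars K).restrict (p := annihilator e D) (q := P.restrictScalars K)
        fun c hc => ⟨c, hc, rfl⟩
    have hs : Function.Surjective s := by
      rintro ⟨_, c, hc, rfl⟩
      exact ⟨⟨c, hc⟩, rfl⟩
    have hγ : LinearMap.ker γ ≤ LinearMap.ker s := by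
      intro c hc
      have hc' : ∀ i, φ (b i * c) = 0 := fun i => congrFun hc i
      refine Subtype.ext ?_
      change N.mkQ (c : A) = 0
      rw [Submodule.mkQ_apply, Submodule.Quotient.mk_eq_zero, hN]
      ext a
      have := hφ _ (Submodule.mul_mem_mul (hb a) c.2)
      rw [sub_mul, map_sub, sub_eq_zero] at this
      simp [hΨ, this, Finset.sum_mul, hc']
    have : FiniteDimensional K (annihilator e D ⧸ LinearMap.ker γ) :=
      LinearEquiv.finiteDimensional γ.quotKerEquivRange.symm
    refine Module.Finite.of_surjective ((LinearMap.ker γ).liftQ s hγ) fun m => ?_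
    obtain ⟨c, rfl⟩ := hs m
    exact ⟨Submodule.Quotient.mk c, rfl⟩
  obtain ⟨-, hr⟩ := h P (A ⧸ N) ((A ⧸ N) ⧸ P) P.subtype P.mkQ P.injective_subtype
    (LinearMap.exact_subtype_mkQ P) P.mkQ_surjective hf₁ (isRational_of_annihilator e hP₁)
    hf₂ (isRational_of_annihilator e hP₂)
  -- Rationality at the class of `1` suffices: some `Y^⊥` kills it, so `Y^⊥` lies in `N` and
  -- therefore in `ker φ`.
  obtain ⟨t, ht⟩ := hr (N.mkQ 1)
  obtain ⟨Y, hY, hYt⟩ := exists_finiteDimensional_lTensor_eq_zero t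
  refine exists_eq_eval e (X := Y) φ fun a ha => ?_
  have h1 : N.mkQ a = 0 := by
    rw [← mul_one a, ← smul_eq_mul, map_smul, ht, hYt _ ha, map_zero]
  rw [Submodule.mkQ_apply, Submodule.Quotient.mk_eq_zero, hN] at h1
  rw [← one_mul a, ← hΨ, h1]
  rfl

theorem closedUnderExt_iff_squaresOpen (hC : HasEnoughTwoSided e) :
    ClosedUnderExt e ↔ SquaresOpen e :=
  ⟨fun h => h.squaresOpen, fun h => h.closedUnderExt e hC⟩

end Algebra

/-! ### Open, closed and cofinite subspaces in the finite topology. -/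

section Topology

variable {K : Type u} {C : Type v} [Field K] [AddCommGroup C] [Module K C] [Coalgebra K C]

theorem perp_anti {X Y : Submodule K C} (h : X ≤ Y) : perp Y ≤ perp X :=
  fun _ hf x hx => hf x (h hx)

theorem isOpenSubspace_iff {I : Submodule K (DualAlg K C)} :
    IsOpenSubspace I ↔ ∃ X : Submodule K C, FiniteDimensional K X ∧ perp X ≤ I := by
  constructor
  · intro h
    obtain ⟨X, hX, hXI⟩ := h 0 I.zero_mem
    exact ⟨X, hX, fun f hf => hXI f hf⟩
  · rintro ⟨X, hX, hXI⟩ f hf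
    refine ⟨X, hX, fun g hg => ?_⟩
    have : g - f ∈ perp X := fun x hx => sub_eq_zero.2 (hg x hx)
    simpa using I.add_mem (hXI this) hf

theorem IsOpenSubspace.mono {I J : Submodule K (DualAlg K C)} (h : IsOpenSubspace I) (hIJ : I ≤ J) :
    IsOpenSubspace J := by
  obtain ⟨X, hX, hXI⟩ := isOpenSubspace_iff.1 h
  exact isOpenSubspace_iff.2 ⟨X, hX, hXI.trans hIJ⟩

theorem isClosedSubspace_iff {I : Submodule K (DualAlg K C)} :
    IsClosedSubspace I ↔ ∀ f ∉ I, ∃ X : Submodule K C, FiniteDimensional K X ∧ f ∉ I ⊔ perp X := by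
  rw [IsClosedSubspace, ← @isOpen_compl_iff _ _ (finiteTopology K C)]
  refine forall₂_congr fun f hf => exists_congr fun X => and_congr_right fun hX => ?_
  constructor
  · intro h hfX
    obtain ⟨g, hg, k, hk, rfl⟩ := Submodule.mem_sup.1 hfX
    refine h g (fun x hx => ?_) hg
    change g x = g x + k x
    rw [hk x hx, add_zero]
  · intro h g hg hgI
    refine h (Submodule.mem_sup.2 ⟨g, hgI, f - g, fun x hx => ?_, by abel⟩)
    exact sub_eq_zero.2 (hg x hx).symm

theorem isCofinite_perp (X : Submodule K C) [FiniteDimensional K X] : IsCofinite (perp X) :=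
  finiteDimensional_of_surjective_of_annihilator (WithConv.linearEquiv K (C →ₗ[K] K)) (X := X)
    (perp X).mkQ (perp X).mkQ_surjective
    fun _ ha => (Submodule.Quotient.mk_eq_zero _).2 ha

theorem isClosedSubspace_and_isCofinite_iff {I : Submodule K (DualAlg K C)} :
    IsClosedSubspace I ∧ IsCofinite I ↔ IsOpenSubspace I := by
  constructor
  · rintro ⟨hc, hf⟩
    rw [isClosedSubspace_iff] at hc
    let S : Set (Submodule K (DualAlg K C ⧸ I)) :=
      {P | ∃ X : Submodule K C, FiniteDimensional K X ∧ P = (perp X).map I.mkQ}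
    have : IsArtinian K (DualAlg K C ⧸ I) :=
      have : FiniteDimensional K (DualAlg K C ⧸ I) := hf
      inferInstance
    -- The images of the `X^⊥` in the finite dimensional quotient have a minimal member. It must be
    -- zero: an `f` outside `I` is separated from `I` by some `Y^⊥`, and `X ⊔ Y` would give a
    -- strictly smaller image.
    obtain ⟨_, ⟨X, hX, rfl⟩, hmin⟩ := IsArtinian.set_has_minimal S ⟨_, ⊥, inferInstance, rfl⟩
    refine isOpenSubspace_iff.2 ⟨X, hX, fun f hfX => ?_⟩
    by_contra hfI
    obtain ⟨Y, hY, hfY⟩ := hc f hfI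
    refine hmin _ ⟨X ⊔ Y, inferInstance, rfl⟩ ?_
    refine lt_of_le_of_ne (Submodule.map_mono (perp_anti le_sup_left)) fun heq => ?_
    have h1 : I.mkQ f ∈ (perp (X ⊔ Y)).map I.mkQ := heq ▸ Submodule.mem_map_of_mem hfX
    obtain ⟨g, hg, hgf⟩ := h1
    refine hfY (Submodule.mem_sup.2 ⟨f - g, ?_, g, perp_anti le_sup_right hg, by abel⟩)
    rw [← Submodule.Quotient.mk_eq_zero, ← Submodule.mkQ_apply, map_sub, hgf, sub_self]
  · intro h
    obtain ⟨X, hX, hXI⟩ := isOpenSubspace_iff.1 h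
    constructor
    · refine isClosedSubspace_iff.2 fun f hf => ⟨X, hX, ?_⟩
      rwa [sup_eq_left.2 hXI]
    · have : FiniteDimensional K (DualAlg K C ⧸ perp X) := isCofinite_perp X
      exact Module.Finite.of_surjective _ (Submodule.factor_surjective hXI)

end Topology

/-! ### Slices of the comultiplication and finite dimensional subcoalgebras. -/

section Coalgebra

variable {K : Type u} {C : Type v} [Field K] [AddCommGroup C] [Module K C]

theorem mem_range_lTensor_subtype {X : Submodule K C} {t : C ⊗[K] C}
    (h : ∀ f : C →ₗ[K] K, TensorProduct.lid K C (f.rTensor C t) ∈ X) :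
    t ∈ LinearMap.range (X.subtype.lTensor C) := by
  classical
  refine (lTensor_exact C (LinearMap.exact_subtype_mkQ X) X.mkQ_surjective t).1 ?_
  -- A tensor in `C ⊗ (C ⧸ X)` vanishes when all its coordinates along a basis of the left factor
  -- do, and these coordinates are slices.
  let B := Module.Basis.ofVectorSpace K C
  refine (TensorProduct.equivFinsuppOfBasisLeft B).injective ?_
  ext i
  rw [TensorProduct.equivFinsuppOfBasisLeft_apply, map_zero, Finsupp.zero_apply]
  have h1 : TensorProduct.lid K (C ⧸ X) ((B.coord i).rTensor (C ⧸ X) (X.mkQ.lTensor C t)) =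
      X.mkQ (TensorProduct.lid K C ((B.coord i).rTensor C t)) := by
    clear h
    induction t with
    | zero => simp
    | tmul x y => simp
    | add x y hx hy => simp only [map_add, hx, hy]
  rw [h1, Submodule.mkQ_apply, Submodule.Quotient.mk_eq_zero]
  exact h _

theorem mem_range_rTensor_subtype {X : Submodule K C} {t : C ⊗[K] C}
    (h : ∀ f : C →ₗ[K] K, TensorProduct.rid K C (f.lTensor C t) ∈ X) :
    t ∈ LinearMap.range (X.subtype.rTensor C) := by
  obtain ⟨s, hs⟩ := mem_range_lTensor_subtype (X := X) (t := TensorProduct.comm K C C t)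
    fun f => by
      rw [LinearMap.rTensor_comm, TensorProduct.lid_comm]
      exact h f
  refine ⟨TensorProduct.comm K C X s, ?_⟩
  rw [LinearMap.rTensor_comm, hs, TensorProduct.comm_comm]

theorem exists_finiteDimensional_forall_slice_mem (t : C ⊗[K] C) :
    ∃ Y : Submodule K C, FiniteDimensional K Y ∧ ∀ f : C →ₗ[K] K,
      TensorProduct.lid K C (f.rTensor C t) ∈ Y ∧ TensorProduct.rid K C (f.lTensor C t) ∈ Y := by
  induction t with
  | zero => exact ⟨⊥, inferInstance, by simp⟩
  | tmul x y =>
    refine ⟨(K ∙ x) ⊔ (K ∙ y), inferInstance, fun f => ?_⟩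
    simp only [LinearMap.rTensor_tmul, LinearMap.lTensor_tmul, TensorProduct.lid_tmul,
      TensorProduct.rid_tmul]
    exact ⟨Submodule.smul_mem _ _ (Submodule.mem_sup_right (Submodule.mem_span_singleton_self y)),
      Submodule.smul_mem _ _ (Submodule.mem_sup_left (Submodule.mem_span_singleton_self x))⟩
  | add s t hs ht =>
    obtain ⟨X, hX, hXs⟩ := hs
    obtain ⟨Y, hY, hYt⟩ := ht
    refine ⟨X ⊔ Y, inferInstance, fun f => ?_⟩
    simp only [map_add]
    exact ⟨add_mem (Submodule.mem_sup_left (hXs f).1) (Submodule.mem_sup_right (hYt f).1),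
      add_mem (Submodule.mem_sup_left (hXs f).2) (Submodule.mem_sup_right (hYt f).2)⟩

variable [Coalgebra K C]

/-- The left slice `c ↦ ∑ f(c₁) c₂`. -/
def leftSlice (f : DualAlg K C) : C →ₗ[K] C :=
  (TensorProduct.lid K C).toLinearMap ∘ₗ f.ofConv.rTensor C ∘ₗ Coalgebra.comul

/-- The right slice `c ↦ ∑ c₁ f(c₂)`. -/
def rightSlice (f : DualAlg K C) : C →ₗ[K] C :=
  (TensorProduct.rid K C).toLinearMap ∘ₗ f.ofConv.lTensor C ∘ₗ Coalgebra.comul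

/-- Slicing is transpose to multiplication. Since functionals separate points of `C`, the identities
between slices below follow from the unit and associativity laws of `C^*`. -/
theorem apply_leftSlice (f g : DualAlg K C) (c : C) : g (leftSlice f c) = (f * g) c := by
  rw [LinearMap.convMul_apply]
  change g.ofConv (TensorProduct.lid K C (f.ofConv.rTensor C (Coalgebra.comul c))) = _
  generalize Coalgebra.comul (R := K) c = t
  induction t with
  | zero => simp
  | tmul x y => simp
  | add x y hx hy => simp only [map_add, hx, hy]

theorem apply_rightSlice (f g : DualAlg K C) (c : C) : g (rightSlice f c) = (g * f) c := by
  rw [LinearMap.convMul_apply]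
  change g.ofConv (TensorProduct.rid K C (f.ofConv.lTensor C (Coalgebra.comul c))) = _
  generalize Coalgebra.comul (R := K) c = t
  induction t with
  | zero => simp
  | tmul x y => simp [mul_comm]
  | add x y hx hy => simp only [map_add, hx, hy]

omit [Coalgebra K C] in
theorem eq_of_forall_dualAlg {c d : C} (h : ∀ f : DualAlg K C, f c = f d) : c = d := by
  rw [← sub_eq_zero, ← Module.forall_dual_apply_eq_zero_iff K]
  intro f
  rw [map_sub, sub_eq_zero]
  exact h (WithConv.toConv f)

theorem leftSlice_leftSlice (f g : DualAlg K C) (c : C) :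
    leftSlice f (leftSlice g c) = leftSlice (g * f) c :=
  eq_of_forall_dualAlg fun h => by
    rw [apply_leftSlice, apply_leftSlice, apply_leftSlice, mul_assoc]

theorem rightSlice_rightSlice (f g : DualAlg K C) (c : C) :
    rightSlice f (rightSlice g c) = rightSlice (f * g) c :=
  eq_of_forall_dualAlg fun h => by
    rw [apply_rightSlice, apply_rightSlice, apply_rightSlice, mul_assoc]

theorem leftSlice_rightSlice (f g : DualAlg K C) (c : C) :
    leftSlice f (rightSlice g c) = rightSlice g (leftSlice f c) :=
  eq_of_forall_dualAlg fun h => by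
    rw [apply_leftSlice, apply_rightSlice, apply_rightSlice, apply_leftSlice, mul_assoc]

theorem leftSlice_one (c : C) : leftSlice (1 : DualAlg K C) c = c :=
  eq_of_forall_dualAlg fun h => by rw [apply_leftSlice, one_mul]

theorem rightSlice_one (c : C) : rightSlice (1 : DualAlg K C) c = c :=
  eq_of_forall_dualAlg fun h => by rw [apply_rightSlice, mul_one]

theorem exists_finiteDimensional_forall_slices_mem (X : Submodule K C) [FiniteDimensional K X] :
    ∃ Y : Submodule K C, FiniteDimensional K Y ∧
      ∀ f : DualAlg K C, ∀ x ∈ X, leftSlice f x ∈ Y ∧ rightSlice f x ∈ Y := by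
  let B := Module.finBasis K X
  choose Y hY hYB using fun i =>
    exists_finiteDimensional_forall_slice_mem (Coalgebra.comul (R := K) (B i : C))
  refine ⟨⨆ i, Y i, inferInstance, fun f x hx => ?_⟩
  have hx' : x = ∑ i, B.repr ⟨x, hx⟩ i • (B i : C) := by
    have := congrArg X.subtype (B.sum_repr ⟨x, hx⟩)
    rw [map_sum] at this
    exact this.symm
  rw [hx', map_sum, map_sum]
  refine ⟨Submodule.sum_mem _ fun i _ => ?_, Submodule.sum_mem _ fun i _ => ?_⟩
  · rw [map_smul]
    exact Submodule.smul_mem _ _ (Submodule.mem_iSup_of_mem i (hYB i f.ofConv).1)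
  · rw [map_smul]
    exact Submodule.smul_mem _ _ (Submodule.mem_iSup_of_mem i (hYB i f.ofConv).2)

/-- The fundamental theorem of coalgebras: every finite dimensional subspace lies in a finite
dimensional one that is stable under all slices. -/
theorem exists_finiteDimensional_slice_stable (X : Submodule K C) [FiniteDimensional K X] :
    ∃ D : Submodule K C, FiniteDimensional K D ∧ X ≤ D ∧
      ∀ f : DualAlg K C, ∀ x ∈ D, leftSlice f x ∈ D ∧ rightSlice f x ∈ D := by
  -- Close up under left slices, then under right slices. The second closure keeps left stability
  -- because the two kinds of slices commute.
  let D₁ := Submodule.span K {d : C | ∃ f : DualAlg K C, ∃ x ∈ X, leftSlice f x = d}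
  let D₂ := Submodule.span K {d : C | ∃ f : DualAlg K C, ∃ x ∈ D₁, rightSlice f x = d}
  have h₁ : FiniteDimensional K D₁ := by
    obtain ⟨Y, hY, h⟩ := exists_finiteDimensional_forall_slices_mem X
    refine Submodule.finiteDimensional_of_le (S₂ := Y) (Submodule.span_le.2 ?_)
    rintro _ ⟨f, x, hx, rfl⟩
    exact (h f x hx).1
  have h₂ : FiniteDimensional K D₂ := by
    obtain ⟨Y, hY, h⟩ := exists_finiteDimensional_forall_slices_mem D₁
    refine Submodule.finiteDimensional_of_le (S₂ := Y) (Submodule.span_le.2 ?_)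
    rintro _ ⟨f, x, hx, rfl⟩
    exact (h f x hx).2
  have hl : ∀ f : DualAlg K C, D₁ ≤ D₁.comap (leftSlice f) := by
    refine fun f => Submodule.span_le.2 ?_
    rintro _ ⟨g, x, hx, rfl⟩
    exact Submodule.subset_span ⟨g * f, x, hx, (leftSlice_leftSlice f g x).symm⟩
  have hl₂ : ∀ f : DualAlg K C, D₂ ≤ D₂.comap (leftSlice f) := by
    refine fun f => Submodule.span_le.2 ?_
    rintro _ ⟨g, x, hx, rfl⟩
    exact Submodule.subset_span ⟨g, _, hl f hx, (leftSlice_rightSlice f g x).symm⟩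
  have hr₂ : ∀ f : DualAlg K C, D₂ ≤ D₂.comap (rightSlice f) := by
    refine fun f => Submodule.span_le.2 ?_
    rintro _ ⟨g, x, hx, rfl⟩
    exact Submodule.subset_span ⟨f * g, x, hx, (rightSlice_rightSlice f g x).symm⟩
  refine ⟨D₂, h₂, fun x hx => ?_, fun f x hx => ⟨hl₂ f hx, hr₂ f hx⟩⟩
  exact Submodule.subset_span ⟨1, x, Submodule.subset_span ⟨1, x, hx, leftSlice_one x⟩,
    rightSlice_one x⟩

variable {D : Submodule K C}

theorem isLeftSubcomodule_of_slice_stable (h : ∀ f : DualAlg K C, ∀ x ∈ D, leftSlice f x ∈ D) :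
    IsLeftSubcomodule D := fun x hx =>
  mem_range_lTensor_subtype fun f => h (WithConv.toConv f) x hx

theorem isRightSubcomodule_of_slice_stable (h : ∀ f : DualAlg K C, ∀ x ∈ D, rightSlice f x ∈ D) :
    IsRightSubcomodule D := fun x hx =>
  mem_range_rTensor_subtype fun f => h (WithConv.toConv f) x hx

theorem isLeftIdeal_perp (h : ∀ f : DualAlg K C, ∀ x ∈ D, leftSlice f x ∈ D) :
    IsLeftIdeal (perp D) := fun f g hg x hx => by
  rw [← apply_leftSlice]
  exact hg _ (h f x hx)

theorem isRightIdeal_perp (h : ∀ f : DualAlg K C, ∀ x ∈ D, rightSlice f x ∈ D) :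
    IsRightIdeal (perp D) := fun f g hg x hx => by
  rw [← apply_rightSlice]
  exact hg _ (h f x hx)

theorem isOpenSubspace_perp [FiniteDimensional K D] : IsOpenSubspace (perp D) :=
  isOpenSubspace_iff.2 ⟨D, inferInstance, le_rfl⟩

theorem IsLeftIdeal.mul {I J : Submodule K (DualAlg K C)} (h : IsLeftIdeal I) :
    IsLeftIdeal (I * J) := fun f g hg => by
  refine Submodule.mul_induction_on hg (fun a ha b hb => ?_) fun a b ha hb => ?_
  · rw [← mul_assoc]
    exact Submodule.mul_mem_mul (h f a ha) hb
  · rw [mul_add]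
    exact add_mem ha hb

theorem IsRightIdeal.mul {I J : Submodule K (DualAlg K C)} (h : IsRightIdeal J) :
    IsRightIdeal (I * J) := fun f g hg => by
  refine Submodule.mul_induction_on hg (fun a ha b hb => ?_) fun a b ha hb => ?_
  · rw [mul_assoc]
    exact Submodule.mul_mem_mul ha (h f b hb)
  · rw [add_mul]
    exact add_mem ha hb

end Coalgebra

/-! ### Reduction of every condition to `ProductsOpen`. -/

section Equivalences

variable (K : Type u) (C : Type v) [Field K] [AddCommGroup C] [Module K C] [Coalgebra K C]

/-- Products of open subspaces of `C^*` are open. -/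
def ProductsOpen : Prop :=
  ∀ I J : Submodule K (DualAlg K C), IsOpenSubspace I → IsOpenSubspace J → IsOpenSubspace (I * J)

variable {K C}

/-- Openness passes to larger subspaces, so one `D` containing both `X` and `Y` replaces two
different factors by a square. -/
theorem productsOpen_of_slice_stable
    (h : ∀ D : Submodule K C, FiniteDimensional K D →
      (∀ f : DualAlg K C, ∀ x ∈ D, leftSlice f x ∈ D) →
      (∀ f : DualAlg K C, ∀ x ∈ D, rightSlice f x ∈ D) →
      IsOpenSubspace (perp D * perp D)) : ProductsOpen K C := by
  intro I J hI hJ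
  obtain ⟨X, hX, hXI⟩ := isOpenSubspace_iff.1 hI
  obtain ⟨Y, hY, hYJ⟩ := isOpenSubspace_iff.1 hJ
  obtain ⟨D, hD, hXD, hs⟩ := exists_finiteDimensional_slice_stable (X ⊔ Y)
  refine (h D hD (fun f x hx => (hs f x hx).1) fun f x hx => (hs f x hx).2).mono ?_
  exact mul_le_mul' ((perp_anti (le_sup_left.trans hXD)).trans hXI)
    ((perp_anti (le_sup_right.trans hXD)).trans hYJ)

theorem productsOpen_iff_left :
    (∀ I ∈ closedCofiniteLeftIdeals K C, ∀ J ∈ closedCofiniteLeftIdeals K C,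
      I * J ∈ closedCofiniteLeftIdeals K C) ↔ ProductsOpen K C := by
  simp only [closedCofiniteLeftIdeals, isClosedSubspace_and_isCofinite_iff, Set.mem_ofPred_eq]
  refine ⟨fun h => productsOpen_of_slice_stable fun D hD hl hr => ?_,
    fun h I hI J hJ => ⟨hI.1.mul, h I J hI.2 hJ.2⟩⟩
  have hD' := And.intro (isLeftIdeal_perp hl) (isOpenSubspace_perp (D := D))
  exact (h _ hD' _ hD').2

theorem productsOpen_iff_right :
    (∀ I ∈ closedCofiniteRightIdeals K C, ∀ J ∈ closedCofiniteRightIdeals K C,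
      I * J ∈ closedCofiniteRightIdeals K C) ↔ ProductsOpen K C := by
  simp only [closedCofiniteRightIdeals, isClosedSubspace_and_isCofinite_iff, Set.mem_ofPred_eq]
  refine ⟨fun h => productsOpen_of_slice_stable fun D hD hl hr => ?_,
    fun h I hI J hJ => ⟨hJ.1.mul, h I J hI.2 hJ.2⟩⟩
  have hD' := And.intro (isRightIdeal_perp hr) (isOpenSubspace_perp (D := D))
  exact (h _ hD' _ hD').2

theorem productsOpen_iff_twoSided :
    (∀ I ∈ closedCofiniteTwoSidedIdeals K C, ∀ J ∈ closedCofiniteTwoSidedIdeals K C,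
      I * J ∈ closedCofiniteTwoSidedIdeals K C) ↔ ProductsOpen K C := by
  simp only [closedCofiniteTwoSidedIdeals, isClosedSubspace_and_isCofinite_iff, Set.mem_ofPred_eq]
  refine ⟨fun h => productsOpen_of_slice_stable fun D hD hl hr => ?_,
    fun h I hI J hJ => ⟨hI.1.mul, hJ.2.1.mul, h I J hI.2.2 hJ.2.2⟩⟩
  have hD' := And.intro (isLeftIdeal_perp hl)
    (And.intro (isRightIdeal_perp hr) (isOpenSubspace_perp (D := D)))
  exact (h _ hD' _ hD').2.2

theorem productsOpen_iff_leftSubcomodule :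
    (∀ X Y : Submodule K C, IsLeftSubcomodule X → FiniteDimensional K X →
      IsLeftSubcomodule Y → FiniteDimensional K Y →
        IsClosedSubspace (perp X * perp Y) ∧ IsCofinite (perp X * perp Y)) ↔
      ProductsOpen K C := by
  simp only [isClosedSubspace_and_isCofinite_iff]
  refine ⟨fun h => productsOpen_of_slice_stable fun D hD hl hr => ?_,
    fun h X Y _ _ _ _ => h _ _ isOpenSubspace_perp isOpenSubspace_perp⟩
  have hD' := isLeftSubcomodule_of_slice_stable hl
  exact h D D hD' hD hD' hD

theorem productsOpen_iff_rightSubcomodule :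
    (∀ X Y : Submodule K C, IsRightSubcomodule X → FiniteDimensional K X →
      IsRightSubcomodule Y → FiniteDimensional K Y →
        IsClosedSubspace (perp X * perp Y) ∧ IsCofinite (perp X * perp Y)) ↔
      ProductsOpen K C := by
  simp only [isClosedSubspace_and_isCofinite_iff]
  refine ⟨fun h => productsOpen_of_slice_stable fun D hD hl hr => ?_,
    fun h X Y _ _ _ _ => h _ _ isOpenSubspace_perp isOpenSubspace_perp⟩
  have hD' := isRightSubcomodule_of_slice_stable hr
  exact h D D hD' hD hD' hD

theorem leftRationalClosedUnderExt_iff : LeftRationalClosedUnderExt K C ↔ ProductsOpen K C := by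
  let e : DualAlg K C ≃ₗ[K] (C →ₗ[K] K) := WithConv.linearEquiv K (C →ₗ[K] K)
  have hC : HasEnoughTwoSided e := by
    intro X hX
    obtain ⟨D, hD, hXD, hs⟩ := exists_finiteDimensional_slice_stable X
    exact ⟨D, hD, hXD, fun f g hg => ⟨isLeftIdeal_perp (fun f x hx => (hs f x hx).1) f g hg,
      isRightIdeal_perp (fun f x hx => (hs f x hx).2) f g hg⟩⟩
  refine Iff.trans (b := ClosedUnderExt e) Iff.rfl ((closedUnderExt_iff_squaresOpen e hC).trans ?_)
  constructor
  · refine fun h => productsOpen_of_slice_stable fun D hD hl hr => isOpenSubspace_iff.2 ?_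
    exact h D hD fun f g hg => ⟨isLeftIdeal_perp hl f g hg, isRightIdeal_perp hr f g hg⟩
  · intro h D hD _
    exact isOpenSubspace_iff.1 (h (perp D) (perp D) isOpenSubspace_perp isOpenSubspace_perp)

/-- Right modules are left modules over the opposite algebra, which is also identified with the dual
of `C`, so the general equivalence applies again. -/
theorem rightRationalClosedUnderExt_iff : RightRationalClosedUnderExt K C ↔ ProductsOpen K C := by
  let e : (DualAlg K C)ᵐᵒᵖ ≃ₗ[K] (C →ₗ[K] K) :=
    (MulOpposite.opLinearEquiv K).symm ≪≫ₗ WithConv.linearEquiv K (C →ₗ[K] K)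
  have hmem : ∀ X : Submodule K C, annihilator e X =
      (perp X).map (MulOpposite.opLinearEquiv K : DualAlg K C ≃ₗ[K] (DualAlg K C)ᵐᵒᵖ).toLinearMap := by
    intro X
    ext f
    exact ⟨fun h => ⟨f.unop, h, rfl⟩, by rintro ⟨g, hg, rfl⟩; exact hg⟩
  have hC : HasEnoughTwoSided e := by
    intro X hX
    obtain ⟨D, hD, hXD, hs⟩ := exists_finiteDimensional_slice_stable X
    exact ⟨D, hD, hXD, fun f g hg =>
      ⟨isRightIdeal_perp (fun f x hx => (hs f x hx).2) f.unop g.unop hg,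
        isLeftIdeal_perp (fun f x hx => (hs f x hx).1) f.unop g.unop hg⟩⟩
  have hr : ∀ (M : Type (max u v)) [AddCommGroup M] [Module K M] [Module (DualAlg K C)ᵐᵒᵖ M],
      IsRationalRight K C M ↔ IsRational e M := by
    intro M _ _ _
    refine forall_congr' fun m => ?_
    constructor
    · rintro ⟨t, ht⟩
      refine ⟨TensorProduct.comm K C M t, fun a => ?_⟩
      rw [LinearMap.lTensor_comm, TensorProduct.rid_comm]
      exact ht a.unop
    · rintro ⟨t, ht⟩
      refine ⟨TensorProduct.comm K M C t, fun a => ?_⟩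
      rw [LinearMap.rTensor_comm, TensorProduct.lid_comm]
      exact ht (MulOpposite.op a)
  refine Iff.trans (b := ClosedUnderExt e) ?_ ((closedUnderExt_iff_squaresOpen e hC).trans ?_)
  · simp only [RightRationalClosedUnderExt, hr]
    rfl
  -- Passing to the opposite algebra reverses products, which does not affect a square.
  · simp only [SquaresOpen, hmem, ← Submodule.map_op_mul]
    have hle : ∀ I J : Submodule K (DualAlg K C),
        I.map (MulOpposite.opLinearEquiv K : DualAlg K C ≃ₗ[K] (DualAlg K C)ᵐᵒᵖ).toLinearMap ≤
          J.map (MulOpposite.opLinearEquiv K : DualAlg K C ≃ₗ[K] (DualAlg K C)ᵐᵒᵖ).toLinearMap ↔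
        I ≤ J := fun I J =>
      Submodule.map_le_map_iff_of_injective (MulOpposite.opLinearEquiv K).injective I J
    simp only [hle, ← isOpenSubspace_iff]
    constructor
    · refine fun h => productsOpen_of_slice_stable fun D hD hl hr => h D hD ?_
      exact fun f g hg => ⟨isRightIdeal_perp hr f.unop g.unop hg,
        isLeftIdeal_perp hl f.unop g.unop hg⟩
    · exact fun h D hD _ => h _ _ isOpenSubspace_perp isOpenSubspace_perp

end Equivalences

end RationalExt

theorem propositionp3 {K : Type*} {C : Type*} [Field K] [AddCommGroup C] [Module K C]
    [Coalgebra K C] :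
    (∀ I : Submodule K (RationalExt.DualAlg K C),
      (RationalExt.IsClosedSubspace I ∧ RationalExt.IsCofinite I) ↔
        RationalExt.IsOpenSubspace I) ∧
    List.TFAE [
      RationalExt.LeftRationalClosedUnderExt K C,
      RationalExt.RightRationalClosedUnderExt K C,
      (∀ I ∈ RationalExt.closedCofiniteLeftIdeals K C,
        ∀ J ∈ RationalExt.closedCofiniteLeftIdeals K C,
          I * J ∈ RationalExt.closedCofiniteLeftIdeals K C),
      (∀ X Y : Submodule K C,
        RationalExt.IsLeftSubcomodule X → FiniteDimensional K X →
        RationalExt.IsLeftSubcomodule Y → FiniteDimensional K Y →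
          RationalExt.IsClosedSubspace (RationalExt.perp X * RationalExt.perp Y) ∧
          RationalExt.IsCofinite (RationalExt.perp X * RationalExt.perp Y)),
      (∀ I ∈ RationalExt.closedCofiniteTwoSidedIdeals K C,
        ∀ J ∈ RationalExt.closedCofiniteTwoSidedIdeals K C,
          I * J ∈ RationalExt.closedCofiniteTwoSidedIdeals K C),
      (∀ I ∈ RationalExt.closedCofiniteRightIdeals K C,
        ∀ J ∈ RationalExt.closedCofiniteRightIdeals K C,
          I * J ∈ RationalExt.closedCofiniteRightIdeals K C),
      (∀ X Y : Submodule K C,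
        RationalExt.IsRightSubcomodule X → FiniteDimensional K X →
        RationalExt.IsRightSubcomodule Y → FiniteDimensional K Y →
          RationalExt.IsClosedSubspace (RationalExt.perp X * RationalExt.perp Y) ∧
          RationalExt.IsCofinite (RationalExt.perp X * RationalExt.perp Y))] := by
  refine ⟨fun I => RationalExt.isClosedSubspace_and_isCofinite_iff, ?_⟩
  rw [RationalExt.leftRationalClosedUnderExt_iff, RationalExt.rightRationalClosedUnderExt_iff,
    RationalExt.productsOpen_iff_left, RationalExt.productsOpen_iff_leftSubcomodule,
    RationalExt.productsOpen_iff_twoSided, RationalExt.productsOpen_iff_right,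
    RationalExt.productsOpen_iff_rightSubcomodule]
  tfae_finish
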